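/- Let $K=\mathbb{Q}(i)$ or $K=\mathbb{Q}(\omega)$ with $\omega=e^{2\pi i/3}$. Let $L\subset\mathbb{C}$ be a finite Galois extension of $K$ of degree $n$ whose Galois group is cyclic, generated by $\sigma$. Let $\gamma\in\mathcal{O}_K$ be such that none of $\gamma,\gamma^2,\dots,\gamma^{n-1}$ is the norm $N_{L/K}(y)$ of an element $y\in L$ (so that the cyclic algebra $(L/K,\sigma,\gamma)$ is a division algebra). Let $\mathfrak{I}=\alpha\mathcal{O}_L$ with $0\neq\alpha\in\mathcal{O}_L$, and for $x=(x_0,\dots,x_{n-1})\in\mathcal{O}_L^n$ let $$X(x)=\mathrm{diag}\bigl(\alpha,\sigma(\alpha),\dots,\sigma^{n-1}(\alpha)\bigr)\begin{pmatrix}x_0&x_1&\cdots&x_{n-1}\\ \gamma\sigma(x_{n-1})&\sigma(x_0)&\cdots&\sigma(x_{n-2})\\ \vdots&&\ddots&\vdots\\ \gamma\sigma^{n-1}(x_1)&\gamma\sigma^{n-1}(x_2)&\cdots&\sigma^{n-1}(x_0)\end{pmatrix}.$$ Let $\mathfrak{q}_1,\dots,\mathfrak{q}_m$ be nonzero, pairwise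 coprime ideals of $\mathcal{O}_L$, let $\mathfrak{q}=\mathfrak{q}_1\cdots\mathfrak{q}_m$, and let $\mathcal{M}:\prod_k\mathcal{O}_L/\mathfrak{q}_k\to\mathcal{O}_L$ assign to each residue tuple a representative in $\mathcal{O}_L$ (the inverse Chinese remainder isomorphism followed by a choice of coset leaders of $\mathcal{O}_L/\mathfrak{q}$). The $k$-th message is $w_k=(w_{k,0},\dots,w_{k,n-1})\in(\mathcal{O}_L/\mathfrak{q}_k)^n$. The layered space-time index code (LSTIC) sends $(w_1,\dots,w_m)$ to $X(x)$ with $x_\ell=\mathcal{M}(w_{1,\ell},\dots,w_{m,\ell})$; let $\mathcal{C}$ be the set of all codewords. For $\mathcal{S}\subseteq\{1,\dots,m\}$ and given message values $v_s$, $s\in\mathcal{S}$, let $\mathcal{C}_{\mathcal{S}}$ be the set of codewords of message tuples with $w_s=v_s$ for all $s\in\mathcal{S}$. As lattice codes, i.e. with each layer $x_\ell$ read modulo $\mathfrak{q}$, the codes $\mathcal{C}$ and $\mathcal{C}_{\mathcal{S}}$ stand for $\mathcal{C}+X(\mathfrak{q}^n)$ and $\mathcal{C}_{\mathcal{S}}+X(\mathfrak{q}^n)$,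 where $X(\mathfrak{q}^n)=\{X(z): z_0,\dots,z_{n-1}\in\mathfrak{q}\}$. For a code $\mathcal{D}$ let $\delta(\mathcal{D})=\min_{X\neq X'\in\mathcal{D}}\det\bigl((X-X')(X-X')^{\dagger}\bigr)$. Let $R_{\mathcal{S}}=\sum_{s\in\mathcal{S}}\frac{1}{2n^2}\log_2\bigl|(\mathcal{O}_L/\mathfrak{q}_s)^n\bigr|$ be the rate of the side information in bits per real symbol, and let the normalized side information gain be $$\Gamma(\mathcal{C},\mathcal{S})=\frac{10\log_{10}\bigl(\delta(\mathcal{C}_{\mathcal{S}})/\delta(\mathcal{C})\bigr)}{n\,R_{\mathcal{S}}}.$$ **Theorem.** Let $\mathcal{S}\subseteq\{1,\dots,m\}$ be such that $\mathfrak{q}_s\neq\mathcal{O}_L$ for at least one $s\in\mathcal{S}$; that is, $R_{\mathcal{S}}>0$. Let the values $v_s$, $s\in\mathcal{S}$, be arbitrary. (1) For the minimum determinants of the lattice codes $\mathcal{C}+X(\mathfrak{q}^n)$ and $\mathcal{C}_{\mathcal{S}}+X(\mathfrak{q}^n)$ (both minima are attained and positive), $\Gamma(\mathcal{C},\mathcal{S})\ge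 20\log_{10}2\approx 6.02$ (the "6 dB" per bit per real symbol). If moreover all $\mathfrak{q}_k$ are principal, then $\Gamma(\mathcal{C},\mathcal{S})=20\log_{10}2$. (2) If the coset leaders $\mathcal{M}(b)$ have minimum energy $\sum_{i=0}^{n-1}|\sigma^i(x)|^2$ in their cosets modulo $\mathfrak{q}$, and $\mathfrak{q}_k\neq\mathcal{O}_L$ for some $k\notin\mathcal{S}$ (so that $\mathcal{C}_{\mathcal{S}}$ has more than one codeword), then also for the minimum determinants of the finite codebooks $\mathcal{C}$ and $\mathcal{C}_{\mathcal{S}}$ themselves (again attained and positive), $\Gamma(\mathcal{C},\mathcal{S})\ge 20\log_{10}2$. -/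

import Mathlib

open scoped NumberField Matrix

noncomputable section

namespace LSTIC

section MinimumDeterminant

variable {n : ℕ}

/-- The values `det ((X - X')(X - X')ᴴ)` over all pairs of distinct codewords of a code `C`.
Each determinant is a nonnegative real number; `re` reads it as such. -/
def pairDets (C : Set (Matrix (Fin n) (Fin n) ℂ)) : Set ℝ :=
  {d | ∃ X ∈ C, ∃ X' ∈ C, X ≠ X' ∧ d = ((X - X') * (X - X')ᴴ).det.re}

/-- The minimum determinant `δ(C)`. -/
def minDet (C : Set (Matrix (Fin n) (Fin n) ℂ)) : ℝ := sInf (pairDets C)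

/-- `δ(C)` is a genuine minimum (it is attained) and it is positive. -/
def HasMinDet (C : Set (Matrix (Fin n) (Fin n) ℂ)) : Prop :=
  IsLeast (pairDets C) (minDet C) ∧ 0 < minDet C

/-- The normalized side information gain (in dB per bit per real symbol) of a code `C` of
`n × n` matrices (`n` transmit antennas) with subcode `CS`, when the rate of the side
information is `R` bits per real symbol. -/
def sideInfoGain (C CS : Set (Matrix (Fin n) (Fin n) ℂ)) (R : ℝ) : ℝ :=
  10 * Real.logb 10 (minDet CS / minDet C) / (n * R)

end MinimumDeterminant

section Code

variable {K L : Type*} [Field K] [NumberField K] [Field L] [NumberField L] [Algebra K L]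
variable {n m : ℕ}

/-- The matrix form of the element `x₀ + x₁ e + ⋯ + xₙ₋₁ eⁿ⁻¹` of the cyclic algebra
`(L/K, σ, γ)`: the entry in row `i`, column `j` is `σⁱ(xⱼ₋ᵢ)` if `i ≤ j` and
`γ σⁱ(xₙ₊ⱼ₋ᵢ)` if `i > j` (subtraction in `Fin n` is modulo `n`). -/
def cyclicMatrix (σ : L ≃ₐ[K] L) (γ : 𝓞 K) (x : Fin n → 𝓞 L) : Matrix (Fin n) (Fin n) L :=
  Matrix.of fun i j =>
    (if i ≤ j then 1 else algebraMap K L (γ : K)) * (σ ^ (i : ℕ)) ((x (j - i) : 𝓞 L) : L)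

/-- The complex matrix `D(α) · (matrix of x₀ + x₁ e + ⋯ + xₙ₋₁ eⁿ⁻¹)` with
`D(α) = diag(α, σ(α), …, σⁿ⁻¹(α))`; the number field `L` is viewed inside `ℂ` through `ι`. -/
def codeword (ι : L →+* ℂ) (σ : L ≃ₐ[K] L) (γ : 𝓞 K) (α : 𝓞 L) (x : Fin n → 𝓞 L) :
    Matrix (Fin n) (Fin n) ℂ :=
  (Matrix.diagonal (fun i : Fin n => (σ ^ (i : ℕ)) (α : L)) * cyclicMatrix σ γ x).map ι

/-- The energy `∑_{i < n} |σⁱ(x)|²` of a symbol `x`. -/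
def energy (n : ℕ) (ι : L →+* ℂ) (σ : L ≃ₐ[K] L) (x : 𝓞 L) : ℝ :=
  ∑ i ∈ Finset.range n, ‖ι ((σ ^ i) (x : L))‖ ^ 2

/-- `M` inverts the Chinese remainder isomorphism `𝓞_L/(q₁⋯q_m) ≃ ∏ 𝓞_L/q_k`, with values in a
complete set of coset leaders: `M b` is an element of `𝓞_L` with residues `b`. -/
def IsLeaderMap (q : Fin m → Ideal (𝓞 L)) (M : ((k : Fin m) → 𝓞 L ⧸ q k) → 𝓞 L) : Prop :=
  ∀ b k, Ideal.Quotient.mk (q k) (M b) = b k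

/-- Each coset leader has minimum energy in its coset. -/
def HasMinEnergy (n : ℕ) (ι : L →+* ℂ) (σ : L ≃ₐ[K] L) (q : Fin m → Ideal (𝓞 L))
    (M : ((k : Fin m) → 𝓞 L ⧸ q k) → 𝓞 L) : Prop :=
  ∀ b, ∀ x : 𝓞 L, (∀ k, Ideal.Quotient.mk (q k) x = b k) →
    energy n ι σ (M b) ≤ energy n ι σ x

/-- The message tuples `(w₁, …, w_m)`, where `w_k = (w_{k,0}, …, w_{k,n-1}) ∈ (𝓞_L/q_k)ⁿ`. -/
abbrev Messages (n : ℕ) (q : Fin m → Ideal (𝓞 L)) : Type _ :=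
  (k : Fin m) → Fin n → 𝓞 L ⧸ q k

/-- The layered encoder: layer `ℓ` carries `x_ℓ = M(w_{1,ℓ}, …, w_{m,ℓ})`. -/
def encode (ι : L →+* ℂ) (σ : L ≃ₐ[K] L) (γ : 𝓞 K) (α : 𝓞 L) (q : Fin m → Ideal (𝓞 L))
    (M : ((k : Fin m) → 𝓞 L ⧸ q k) → 𝓞 L) (w : Messages n q) : Matrix (Fin n) (Fin n) ℂ :=
  codeword ι σ γ α fun l => M fun k => w k l

/-- The codebook `C` of all codewords. -/
def codebook (ι : L →+* ℂ) (σ : L ≃ₐ[K] L) (γ : 𝓞 K) (α : 𝓞 L) (q : Fin m → Ideal (𝓞 L))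
    (M : ((k : Fin m) → 𝓞 L ⧸ q k) → 𝓞 L) : Set (Matrix (Fin n) (Fin n) ℂ) :=
  {X | ∃ w : Messages n q, X = encode ι σ γ α q M w}

/-- The subcode `C_S` of the codewords compatible with the side information `w_s = v_s`,
`s ∈ S`. -/
def subcode (ι : L →+* ℂ) (σ : L ≃ₐ[K] L) (γ : 𝓞 K) (α : 𝓞 L) (q : Fin m → Ideal (𝓞 L))
    (M : ((k : Fin m) → 𝓞 L ⧸ q k) → 𝓞 L) (S : Finset (Fin m)) (v : Messages n q) :
    Set (Matrix (Fin n) (Fin n) ℂ) :=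
  {X | ∃ d : Messages n q, (∀ k ∈ S, d k = v k) ∧ X = encode ι σ γ α q M d}

/-- The lattice code from which a code `C` is carved when every layer `x_ℓ` is read modulo
`q₁⋯q_m`: all translates of the codewords of `C` by the matrices of the sublattice of those
`x` with all `x_ℓ ∈ q₁⋯q_m`. -/
def latticeCode (ι : L →+* ℂ) (σ : L ≃ₐ[K] L) (γ : 𝓞 K) (α : 𝓞 L) (q : Fin m → Ideal (𝓞 L))
    (C : Set (Matrix (Fin n) (Fin n) ℂ)) : Set (Matrix (Fin n) (Fin n) ℂ) :=
  {Y | ∃ X ∈ C, ∃ z : Fin n → 𝓞 L, (∀ l, z l ∈ ∏ k, q k) ∧ Y = X + codeword ι σ γ α z}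

/-- The rate `R_S = ∑_{s ∈ S} log₂(M_s) / (2n²)` of the side information in bits per real
symbol: message `w_s` takes `M_s = |(𝓞_L/q_s)ⁿ|` values, and a codeword carries `2n²` real
symbols. -/
def sideInfoRate (n : ℕ) (q : Fin m → Ideal (𝓞 L)) (S : Finset (Fin m)) : ℝ :=
  ∑ s ∈ S, Real.logb 2 (Nat.card (Fin n → 𝓞 L ⧸ q s)) / (2 * (n : ℝ) ^ 2)

end Code

end LSTIC

end

set_option linter.unusedSectionVars false

/-! The determinant of a codeword is `N_{L/K}(α)` times the reduced norm of its coordinate vector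
`x`. For `x ≠ 0` the reduced norm `d` is a nonzero element of `𝓞 K`. It is nonzero because otherwise
the left kernel of the matrix, of dimension `t` with `0 < t < n`, would be stable under the
semilinear operator `e` with `eⁿ = γ`, and taking determinants would make `γ^t` a norm
(`det_cyclicMatrix_ne_zero`). It lies in `K` because it is fixed by `σ`.

If all coordinates lie in an ideal `Q`, row `i` of the matrix lies in `σⁱ(Q)`, so `d ∈ ∏ σⁱ(Q)`.
Taking absolute norms in `L` gives `N(Q)ⁿ ∣ N_K(d)ⁿ`, hence `N(Q) ≤ N_K(d)` (`exists_reducedNorm`).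
As `K` is imaginary quadratic, `N_K(d) = |d|²`.

Two codewords that agree on the side information differ by coordinates in `Q = ∏_{s ∈ S} q_s`, so
`δ(C_S) ≥ N(α) N(Q)` (`hasMinDet_of_residues`). The full code has `δ(C) = N(α)`, attained by a
difference with one nonzero layer, of norm one. Since `n R_S = log₂ N(Q) / 2`, the gain is at least
`20 log₁₀ 2`. A generator of `Q` gives equality. For finite codebooks, the minimum-energy leader of
the class of `1` has norm one by the arithmetic-geometric mean inequality. -/

namespace LSTIC

/-! ### Determinants of semilinear maps, and norms from a cyclic extension. -/

section CyclicAlgebra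

variable {K L : Type*} [Field K] [Field L] [Algebra K L]

/-- The iterates of a semilinear map, in coordinates. -/
theorem exists_matrix_iterate {t : ℕ} {W : Type*} [AddCommGroup W] [Module L W]
    (σ : L ≃ₐ[K] L) (b : Module.Basis (Fin t) L W) (E : W →ₛₗ[(σ : L →+* L)] W) :
    ∃ p : L, ∀ k : ℕ, ∃ P : Matrix (Fin t) (Fin t) L,
      (∀ j, E^[k] (b j) = ∑ i, P i j • b i) ∧ P.det = ∏ i ∈ Finset.range k, (σ ^ i) p := by
  set A : Matrix (Fin t) (Fin t) L := Matrix.of fun i j => b.repr (E (b j)) i with hA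
  have hE : ∀ j, E (b j) = ∑ i, A i j • b i := fun j => (b.sum_repr (E (b j))).symm
  refine ⟨A.det, fun k => ?_⟩
  induction k with
  | zero => exact ⟨1, fun j => by simp [Matrix.one_apply], by simp⟩
  | succ k ih =>
    obtain ⟨P, hP, hdet⟩ := ih
    -- Semilinearity conjugates the old coordinates, so determinants satisfy `det P' = p · σ(det P)`
    -- with `p = det A`.
    refine ⟨A * P.map σ, fun j => ?_, ?_⟩
    · rw [Function.iterate_succ_apply', hP, map_sum]
      simp only [LinearMap.map_smulₛₗ, hE, Matrix.mul_apply, Matrix.map_apply, Finset.smul_sum,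
        Finset.sum_smul]
      rw [Finset.sum_comm]
      refine Finset.sum_congr rfl fun i _ => Finset.sum_congr rfl fun l _ => ?_
      rw [smul_smul, mul_comm]
      rfl
    · have h : (P.map σ).det = σ P.det := (AlgEquiv.map_det σ P).symm
      rw [Matrix.det_mul, h, hdet, Finset.prod_range_succ', map_prod, mul_comm]
      simp only [pow_succ', AlgEquiv.mul_apply, pow_zero, AlgEquiv.one_apply]

/-- If a semilinear map on a space of dimension `t` satisfies `Eⁿ = c`, then `cᵗ` is a product
of conjugates. -/
theorem exists_prod_eq_pow {n t : ℕ} {W : Type*} [AddCommGroup W] [Module L W]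
    (σ : L ≃ₐ[K] L) (b : Module.Basis (Fin t) L W) (E : W →ₛₗ[(σ : L →+* L)] W) (c : L)
    (hE : ∀ w, E^[n] w = c • w) : ∃ p : L, ∏ i ∈ Finset.range n, (σ ^ i) p = c ^ t := by
  obtain ⟨p, hp⟩ := exists_matrix_iterate σ b E
  obtain ⟨P, hP, hdet⟩ := hp n
  refine ⟨p, ?_⟩
  have : P = Matrix.diagonal fun _ => c := by
    ext i j
    have h := congrArg (fun w => b.repr w i) ((hP j).symm.trans (hE (b j)))
    simp only [map_sum, map_smul, Module.Basis.repr_self, Finsupp.coe_finsetSum,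
      Finset.sum_apply, Finsupp.smul_apply, smul_eq_mul, Finsupp.single_apply, mul_ite, mul_one,
      mul_zero, Finset.sum_ite_eq', Finset.mem_univ, if_true] at h
    rw [h, Matrix.diagonal_apply]
    simp [eq_comm]
  rw [← hdet, this, Matrix.det_diagonal]
  simp

theorem orderOf_eq_finrank [FiniteDimensional K L] [IsGalois K L] (σ : L ≃ₐ[K] L)
    (hσ : ∀ τ : L ≃ₐ[K] L, τ ∈ Subgroup.zpowers σ) : orderOf σ = Module.finrank K L := by
  rw [orderOf_eq_card_of_forall_mem_zpowers hσ, IsGalois.card_aut_eq_finrank]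

theorem algebraMap_norm_eq_prod_range [FiniteDimensional K L] [IsGalois K L] (σ : L ≃ₐ[K] L)
    (hσ : ∀ τ : L ≃ₐ[K] L, τ ∈ Subgroup.zpowers σ) (y : L) :
    algebraMap K L (Algebra.norm K y) =
      ∏ i ∈ Finset.range (Module.finrank K L), (σ ^ i) y := by
  classical
  rw [Algebra.norm_eq_prod_automorphisms, ← IsCyclic.image_range_orderOf hσ,
    Finset.prod_image, orderOf_eq_finrank σ hσ]
  intro i hi j hj h
  simp only [Finset.coe_range, Set.mem_Iio] at hi hj
  exact pow_injOn_Iio_orderOf hi hj h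

variable {n : ℕ} [NeZero n]

/-- The factor by which the cyclic shift to position `i` multiplies. -/
def wrapFactor (c : L) (i : Fin n) : L := if i = 0 then c else 1

/-- Left multiplication by the generator `e` of the cyclic algebra, in the basis of powers
of `e`. -/
def shift (σ : L ≃ₐ[K] L) (c : L) : (Fin n → L) →ₛₗ[(σ : L →+* L)] (Fin n → L) where
  toFun v i := wrapFactor c i * σ (v (i - 1))
  map_add' v w := by ext i; simp [mul_add]
  map_smul' r v := by ext i; simp; ring

theorem shift_apply (σ : L ≃ₐ[K] L) (c : L) (v : Fin n → L) (i : Fin n) :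
    shift σ c v i = wrapFactor c i * σ (v (i - 1)) := rfl

/-- Within `k ≤ n` shifts an entry wraps around at most once, and it has done so exactly when it
ends at an index below `k`. At `k = n` every entry has wrapped, whence `eⁿ = c`. -/
theorem shift_iterate (σ : L ≃ₐ[K] L) (c : K) (v : Fin n → L) (k : ℕ) (hk : k ≤ n) (i : Fin n) :
    (shift σ (algebraMap K L c))^[k] v i =
      (if (i : ℕ) < k then algebraMap K L c else 1) * (σ ^ k) (v (i - Fin.ofNat n k)) := by
  induction k generalizing i with
  | zero => simp
  | succ k ih =>
    have h1 : i - 1 - Fin.ofNat n k = i - Fin.ofNat n (k + 1) := by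
      rw [sub_sub]
      congr 1
      apply Fin.ext
      simp [Fin.val_add, add_comm]
    rw [Function.iterate_succ_apply', shift_apply, ih (by omega), map_mul, ← mul_assoc, h1,
      pow_succ', AlgEquiv.mul_apply]
    congr 1
    unfold wrapFactor
    by_cases hi : i = 0
    · subst hi
      -- In `Fin n` the predecessor of `0` is `n - 1`, and `k + 1 ≤ n`: no earlier factor `c` has
      -- been collected.
      have : ¬ (((0 : Fin n) - 1 : Fin n) : ℕ) < k := by
        obtain ⟨n, rfl⟩ := Nat.exists_eq_succ_of_ne_zero (NeZero.ne n)
        rw [zero_sub, Fin.coe_neg_one]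
        omega
      simp only [if_neg this, map_one, mul_one, if_true, Fin.coe_ofNat_eq_mod, Nat.zero_mod, Nat.succ_pos]
    · have : ((i - 1 : Fin n) : ℕ) = i - 1 := by
        rw [Fin.val_sub_one_of_ne_zero hi]
      have h0 : (i : ℕ) ≠ 0 := fun h => hi (Fin.ext h)
      rw [if_neg hi, this]
      by_cases h : (i : ℕ) < k + 1
      · rw [if_pos h, if_pos (by omega)]; simp
      · rw [if_neg h, if_neg (by omega)]; simp

end CyclicAlgebra

/-! ### The reduced norm is nonzero and lies in the base field. -/

section CyclicMatrix

theorem val_add_one_cases {n : ℕ} [NeZero n] (i : Fin n) :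
    (i + 1 = 0 ∧ (i : ℕ) + 1 = n) ∨ (i + 1 ≠ 0 ∧ ((i + 1 : Fin n) : ℕ) = i + 1) := by
  obtain ⟨n, rfl⟩ := Nat.exists_eq_succ_of_ne_zero (NeZero.ne n)
  rcases eq_or_ne i (Fin.last n) with rfl | h
  · left; simp
  · right
    have h1 : ((i + 1 : Fin (n + 1)) : ℕ) = i + 1 :=
      Fin.val_add_one_of_lt (Fin.lt_last_iff_ne_last.mpr h)
    refine ⟨fun h0 => ?_, h1⟩
    rw [h0] at h1
    simp at h1

variable {K L : Type*} [Field K] [NumberField K] [Field L] [NumberField L] [Algebra K L]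
variable {n : ℕ} [NeZero n]

/-- Entrywise form of the fact that left multiplication by `e` commutes with right multiplication by
`x`. Both the `σ`-invariance of the determinant and the stability of the kernel come from it. -/
theorem wrapFactor_mul_cyclicMatrix (σ : L ≃ₐ[K] L) (hn : σ ^ n = 1) (γ : 𝓞 K)
    (x : Fin n → 𝓞 L) (i j : Fin n) :
    wrapFactor (algebraMap K L γ) (i + 1) * cyclicMatrix σ γ x (i + 1) (j + 1) =
      σ (cyclicMatrix σ γ x i j) * wrapFactor (algebraMap K L γ) (j + 1) := by
  have hpow : σ ^ ((i + 1 : Fin n) : ℕ) = σ ^ ((i : ℕ) + 1) := by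
    rcases val_add_one_cases i with ⟨h, h'⟩ | ⟨h, h'⟩
    · rw [h, h', hn]; simp
    · rw [h']
  have hsub : j + 1 - (i + 1) = j - i := add_sub_add_right_eq_sub j i 1
  have hcoef : ∀ c : L, wrapFactor c (i + 1) * (if i + 1 ≤ j + 1 then 1 else c) =
      (if i ≤ j then 1 else c) * wrapFactor c (j + 1) := by
    intro c
    have hi_lt := (i + 1).isLt
    have hj_lt := (j + 1).isLt
    unfold wrapFactor
    rcases val_add_one_cases i with ⟨hi, hi'⟩ | ⟨hi, hi'⟩ <;>
    rcases val_add_one_cases j with ⟨hj, hj'⟩ | ⟨hj, hj'⟩ <;>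
    simp only [hi, hj, Fin.le_def, if_true, if_false, hi', hj', Fin.coe_ofNat_eq_mod,
      Nat.zero_mod]
    all_goals
      have := i.isLt
      have := j.isLt
      split_ifs <;> first | omega | simp
  have hσc : σ (if i ≤ j then 1 else algebraMap K L γ) = if i ≤ j then 1 else algebraMap K L γ := by
    split_ifs <;> simp
  simp only [cyclicMatrix, Matrix.of_apply, hpow, hsub, map_mul, pow_succ', AlgEquiv.mul_apply, hσc]
  linear_combination (σ ((σ ^ (i : ℕ)) (x (j - i)))) * hcoef (algebraMap K L γ)

theorem det_cyclicMatrix_fixed (σ : L ≃ₐ[K] L) (hn : σ ^ n = 1) (γ : 𝓞 K) (hγ : γ ≠ 0)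
    (x : Fin n → 𝓞 L) : σ (cyclicMatrix σ γ x).det = (cyclicMatrix σ γ x).det := by
  set c := algebraMap K L γ with hc
  have hc0 : c ≠ 0 := by simpa [hc] using hγ
  have key : Matrix.diagonal (fun i : Fin n => wrapFactor c (i + 1)) *
      (cyclicMatrix σ γ x).submatrix (Equiv.addRight 1) (Equiv.addRight 1) =
      (cyclicMatrix σ γ x).map σ * Matrix.diagonal (fun i : Fin n => wrapFactor c (i + 1)) := by
    ext i j
    rw [Matrix.diagonal_mul, Matrix.mul_diagonal]
    exact wrapFactor_mul_cyclicMatrix σ hn γ x i j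
  have h := congrArg Matrix.det key
  have h2 : ((cyclicMatrix σ γ x).map σ).det = σ (cyclicMatrix σ γ x).det :=
    (AlgEquiv.map_det σ _).symm
  rw [Matrix.det_mul, Matrix.det_mul, Matrix.det_submatrix_equiv_self, h2, mul_comm] at h
  refine (mul_right_cancel₀ ?_ h).symm
  rw [Matrix.det_diagonal]
  refine Finset.prod_ne_zero_iff.mpr fun i _ => ?_
  unfold wrapFactor
  split_ifs
  · exact hc0
  · exact one_ne_zero

theorem shift_vecMul (σ : L ≃ₐ[K] L) (hn : σ ^ n = 1) (γ : 𝓞 K) (x : Fin n → 𝓞 L)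
    (v : Fin n → L) :
    shift σ (algebraMap K L γ) v ᵥ* cyclicMatrix σ γ x =
      shift σ (algebraMap K L γ) (v ᵥ* cyclicMatrix σ γ x) := by
  ext j
  obtain ⟨j, rfl⟩ : ∃ j', j = j' + 1 := ⟨j - 1, by simp⟩
  rw [shift_apply, add_sub_cancel_right]
  simp only [Matrix.vecMul, dotProduct, map_sum, map_mul, Finset.mul_sum]
  rw [← Equiv.sum_comp (Equiv.addRight (1 : Fin n))]
  refine Finset.sum_congr rfl fun i _ => ?_
  rw [Equiv.coe_addRight, shift_apply, add_sub_cancel_right, mul_right_comm,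
    wrapFactor_mul_cyclicMatrix σ hn γ x i j]
  ring

/-- The cyclic algebra is a division algebra if no power `γ, …, γⁿ⁻¹` is a norm. -/
theorem det_cyclicMatrix_ne_zero [IsGalois K L] (hn : Module.finrank K L = n)
    (σ : L ≃ₐ[K] L) (hσ : ∀ τ : L ≃ₐ[K] L, τ ∈ Subgroup.zpowers σ)
    (γ : 𝓞 K) (hγ : ∀ j : ℕ, 1 ≤ j → j < n → ∀ y : L, Algebra.norm K y ≠ (γ : K) ^ j)
    (x : Fin n → 𝓞 L) (hx : x ≠ 0) : (cyclicMatrix σ γ x).det ≠ 0 := by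
  intro hdet
  have hσn : σ ^ n = 1 := by rw [← hn, ← orderOf_eq_finrank σ hσ, pow_orderOf_eq_one]
  set A := cyclicMatrix σ γ x with hA
  -- The left annihilator of `x` in the cyclic algebra. It is closed under left multiplication by
  -- `e`, and `Eⁿ = γ` there, so `γ ^ dim V` is a norm.
  set V : Submodule L (Fin n → L) := LinearMap.ker A.vecMulLinear with hV
  have hmem : ∀ v, v ∈ V ↔ v ᵥ* A = 0 := fun v => by
    rw [hV, LinearMap.mem_ker, Matrix.vecMulLinear_apply]
  set E := shift (n := n) σ (algebraMap K L γ) with hE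
  have hstab : ∀ v ∈ V, E v ∈ V := fun v hv => by
    rw [hmem] at hv ⊢
    rw [hE, shift_vecMul σ hσn, ← hA, hv, map_zero]
  let F : V →ₛₗ[(σ : L →+* L)] V := (E.comp V.subtype).codRestrict V fun v => hstab v v.2
  have hF : ∀ (k : ℕ) (w : V), ((F^[k] w : V) : Fin n → L) = E^[k] w := by
    intro k w
    induction k with
    | zero => rfl
    | succ k ih => rw [Function.iterate_succ_apply', Function.iterate_succ_apply', ← ih]; rfl
  have hFn : ∀ w : V, F^[n] w = algebraMap K L γ • w := by
    intro w
    ext i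
    rw [hF, hE, shift_iterate σ _ _ n le_rfl, hσn, if_pos i.2]
    have : Fin.ofNat n n = 0 := by ext; simp
    rw [this, sub_zero]
    rfl
  obtain ⟨p, hp⟩ := exists_prod_eq_pow (n := n) σ (Module.finBasis L V) F _ hFn
  have hnorm := algebraMap_norm_eq_prod_range σ hσ p
  rw [hn] at hnorm
  rw [← hnorm, ← map_pow] at hp
  refine hγ (Module.finrank L V) ?_ ?_ p ((algebraMap K L).injective hp)
  · obtain ⟨v, hv0, hv⟩ := Matrix.exists_vecMul_eq_zero_iff.mpr hdet
    rw [Nat.one_le_iff_ne_zero, ← pos_iff_ne_zero, Module.finrank_pos_iff]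
    exact ⟨⟨v, (hmem v).mpr hv⟩, 0, fun h => hv0 (congrArg Subtype.val h)⟩
  -- Row `0` of the matrix is `x` itself, so the first basis vector is not in `V`.
  · have : V ≠ ⊤ := by
      rintro h
      apply hx
      ext j
      have h1 : (Pi.single 0 1 : Fin n → L) ᵥ* A = 0 := (hmem _).mp (h ▸ Submodule.mem_top)
      have := congrFun h1 j
      rw [Matrix.single_one_vecMul] at this
      simpa [hA, cyclicMatrix] using this
    simpa using Submodule.finrank_lt this

theorem exists_algebraMap_eq_det [IsGalois K L] (hn : Module.finrank K L = n)
    (σ : L ≃ₐ[K] L) (hσ : ∀ τ : L ≃ₐ[K] L, τ ∈ Subgroup.zpowers σ)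
    (γ : 𝓞 K) (hγ : ∀ j : ℕ, 1 ≤ j → j < n → ∀ y : L, Algebra.norm K y ≠ (γ : K) ^ j)
    (x : Fin n → 𝓞 L) : ∃ a : K, algebraMap K L a = (cyclicMatrix σ γ x).det := by
  have hσn : σ ^ n = 1 := by rw [← hn, ← orderOf_eq_finrank σ hσ, pow_orderOf_eq_one]
  have hfix : σ (cyclicMatrix σ γ x).det = (cyclicMatrix σ γ x).det := by
    -- For `n = 1` the norm condition is vacuous and `γ` may vanish, but then `σ = 1`. For `n > 1`,
    -- `γ ≠ 0` since `0` is the norm of `0`.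
    rcases eq_or_ne n 1 with rfl | h1
    · rw [pow_one] at hσn; rw [hσn]; rfl
    · refine det_cyclicMatrix_fixed σ hσn γ (fun h => ?_) x
      have := NeZero.pos n
      exact hγ 1 le_rfl (by omega) 0 (by simp [h])
  rw [← Set.mem_range, IsGalois.mem_range_algebraMap_iff_fixed]
  intro τ
  obtain ⟨k, rfl⟩ := Subgroup.mem_zpowers_iff.mp (hσ τ)
  have : σ ∈ MulAction.stabilizer (L ≃ₐ[K] L) (cyclicMatrix σ γ x).det := hfix
  exact (Subgroup.zpow_mem _ this k : _ ∈ MulAction.stabilizer (L ≃ₐ[K] L) _)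

end CyclicMatrix

/-! ### The ideal bound for reduced norms. -/

section IdealBound

/-- Every Leibniz term contains one entry from each row. -/
theorem det_mem_prod {R ι : Type*} [CommRing R] [Fintype ι] [DecidableEq ι] (A : Matrix ι ι R)
    (I : ι → Ideal R) (h : ∀ i j, A i j ∈ I i) : A.det ∈ ∏ i, I i := by
  rw [← Matrix.det_transpose, Matrix.det_apply]
  refine Ideal.sum_mem _ fun τ _ => ?_
  rw [Units.smul_def, zsmul_eq_mul]
  exact Ideal.mul_mem_left _ _ (Ideal.prod_mem_prod fun i _ => h i (τ i))

theorem absNorm_map_equiv {R : Type*} [CommRing R] [IsDedekindDomain R]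
    [Module.Free ℤ R] (e : R ≃+* R) (I : Ideal R) :
    Ideal.absNorm (I.map e) = Ideal.absNorm I := by
  rw [Ideal.absNorm_apply, Ideal.absNorm_apply, Submodule.cardQuot_apply,
    Submodule.cardQuot_apply]
  exact (Nat.card_congr (Ideal.quotientEquiv I _ e rfl).toEquiv).symm

variable {K L : Type*} [Field K] [NumberField K] [Field L] [NumberField L] [Algebra K L]
variable {n : ℕ} [NeZero n]

/-- The ring automorphism of `𝓞 L` induced by an automorphism of `L`. -/
def conj (σ : L ≃ₐ[K] L) : 𝓞 L ≃+* 𝓞 L :=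
  NumberField.RingOfIntegers.mapRingEquiv (σ : L ≃+* L)

theorem exists_integer_det_cyclicMatrix (σ : L ≃ₐ[K] L) (γ : 𝓞 K) (x : Fin n → 𝓞 L)
    (Q : Ideal (𝓞 L)) (hQ : ∀ l, x l ∈ Q) :
    ∃ y : 𝓞 L, (y : L) = (cyclicMatrix σ γ x).det ∧
      y ∈ ∏ i : Fin n, Q.map (conj (σ ^ (i : ℕ))) := by
  set A : Matrix (Fin n) (Fin n) (𝓞 L) := Matrix.of fun i j =>
    (if i ≤ j then 1 else algebraMap (𝓞 K) (𝓞 L) γ) * conj (σ ^ (i : ℕ)) (x (j - i)) with hA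
  have hmap : (algebraMap (𝓞 L) L).mapMatrix A = cyclicMatrix σ γ x := by
    ext i j
    simp only [hA, cyclicMatrix, RingHom.mapMatrix_apply, Matrix.map_apply, Matrix.of_apply,
      map_mul]
    congr 1
    split_ifs
    · simp
    · rfl
  refine ⟨A.det, ?_, det_mem_prod _ _ fun i j => ?_⟩
  · rw [← hmap, ← RingHom.map_det]
  · exact Ideal.mul_mem_left _ _ (Ideal.mem_map_of_mem _ (hQ _))

/-- The reduced norm of a nonzero element of the natural order with coordinates in `Q` has
absolute norm at least that of `Q`. -/
theorem exists_reducedNorm [IsGalois K L] (hn : Module.finrank K L = n)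
    (σ : L ≃ₐ[K] L) (hσ : ∀ τ : L ≃ₐ[K] L, τ ∈ Subgroup.zpowers σ)
    (γ : 𝓞 K) (hγ : ∀ j : ℕ, 1 ≤ j → j < n → ∀ y : L, Algebra.norm K y ≠ (γ : K) ^ j)
    (x : Fin n → 𝓞 L) (hx : x ≠ 0) :
    ∃ d : 𝓞 K, algebraMap K L d = (cyclicMatrix σ γ x).det ∧ d ≠ 0 ∧
      ∀ Q : Ideal (𝓞 L), (∀ l, x l ∈ Q) →
        Ideal.absNorm Q ≤ Ideal.absNorm (Ideal.span {d}) := by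
  obtain ⟨a, ha⟩ := exists_algebraMap_eq_det hn σ hσ γ hγ x
  obtain ⟨y, hy, -⟩ := exists_integer_det_cyclicMatrix σ γ x ⊤ fun _ => Submodule.mem_top
  have hint : IsIntegral ℤ a := by
    rw [← isIntegral_algebraMap_iff (algebraMap K L).injective, ha, ← hy]
    exact y.isIntegral_coe
  obtain ⟨d, rfl⟩ : ∃ d : 𝓞 K, (d : K) = a := ⟨⟨a, hint⟩, rfl⟩
  have hd : d ≠ 0 := by
    rintro rfl
    exact det_cyclicMatrix_ne_zero hn σ hσ γ hγ x hx (by rw [← ha]; simp)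
  refine ⟨d, ha, hd, fun Q hQ => ?_⟩
  obtain ⟨y, hy, hmem⟩ := exists_integer_det_cyclicMatrix σ γ x Q hQ
  have hyd : y = algebraMap (𝓞 K) (𝓞 L) d := by
    apply NumberField.RingOfIntegers.ext
    rw [hy, ← ha]
    rfl
  -- The `n` conjugates of `Q` share one absolute norm, while `d`, coming from `K`, has norm
  -- `N_K(d)ⁿ` in `L`.
  have hdvd : Ideal.absNorm Q ^ n ∣ Ideal.absNorm (Ideal.span {d}) ^ n := by
    have h := Ideal.absNorm_dvd_absNorm_of_le ((Ideal.span_singleton_le_iff_mem _).mpr hmem)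
    rw [map_prod] at h
    simp only [absNorm_map_equiv, Finset.prod_const, Finset.card_univ, Fintype.card_fin] at h
    refine h.trans (dvd_of_eq ?_)
    rw [Ideal.absNorm_span_singleton, Ideal.absNorm_span_singleton, hyd, ← Int.natAbs_pow]
    congr 1
    have : ((Algebra.norm ℤ (algebraMap (𝓞 K) (𝓞 L) d) : ℤ) : ℚ) =
        ((Algebra.norm ℤ d ^ n : ℤ) : ℚ) := by
      push_cast
      rw [Algebra.coe_norm_int, Algebra.coe_norm_int, ← hn, ← map_pow,
        ← Algebra.norm_algebraMap, Algebra.norm_norm]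
      rfl
    exact_mod_cast this
  refine Nat.le_of_dvd ?_ ((Nat.pow_dvd_pow_iff (NeZero.ne n)).mp hdvd)
  rw [Nat.pos_iff_ne_zero, Ne, Ideal.absNorm_eq_zero_iff, Ideal.span_singleton_eq_bot]
  exact hd

end IdealBound

/-! ### Complex absolute values and norms over an imaginary quadratic field. -/

section Complex

/-- Such a field has a single infinite place, which is complex and so counts twice in the product of
absolute values giving the norm. -/
theorem norm_sq_eq_abs_norm {K : Type*} [Field K] [NumberField K]
    (hK : IsCyclotomicExtension {4} ℚ K ∨ IsCyclotomicExtension {3} ℚ K) (φ : K →+* ℂ) (a : K) :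
    ‖φ a‖ ^ 2 = |(Algebra.norm ℚ a : ℝ)| := by
  open NumberField InfinitePlace in
  have hr : nrRealPlaces K = 0 := by
    rcases hK with h | h
    · exact IsCyclotomicExtension.Rat.nrRealPlaces_eq_zero (n := 4) K (by norm_num)
    · exact IsCyclotomicExtension.Rat.nrRealPlaces_eq_zero (n := 3) K (by norm_num)
  have hc : nrComplexPlaces K = 1 := by
    rcases hK with h | h
    · rw [IsCyclotomicExtension.Rat.nrComplexPlaces_eq_totient_div_two (n := 4)]; decide
    · rw [IsCyclotomicExtension.Rat.nrComplexPlaces_eq_totient_div_two (n := 3)]; decide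
  have hcard : Fintype.card (InfinitePlace K) = 1 := by
    rw [card_eq_nrRealPlaces_add_nrComplexPlaces, hr, hc]
  have : Subsingleton (InfinitePlace K) := Fintype.card_le_one_iff_subsingleton.mp hcard.le
  have hcx : IsComplex (InfinitePlace.mk φ) := by
    rw [← not_isReal_iff_isComplex]
    exact fun h => (nrRealPlaces_eq_zero_iff.mp hr).isComplex _ |> fun h' =>
      (not_isReal_iff_isComplex.mpr h') h
  have h := prod_eq_abs_norm a
  rw [Fintype.prod_subsingleton _ (InfinitePlace.mk φ), mult, if_neg
    (not_isReal_iff_isComplex.mpr hcx), InfinitePlace.apply] at h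
  rw [h]
  simp

theorem norm_sq_eq_absNorm {K : Type*} [Field K] [NumberField K]
    (hK : IsCyclotomicExtension {4} ℚ K ∨ IsCyclotomicExtension {3} ℚ K) (φ : K →+* ℂ) (a : 𝓞 K) :
    ‖φ a‖ ^ 2 = Ideal.absNorm (Ideal.span {a}) := by
  rw [norm_sq_eq_abs_norm hK, Ideal.absNorm_span_singleton, ← Algebra.coe_norm_int,
    Nat.cast_natAbs]
  simp

end Complex

/-! ### Determinants of codewords. -/

section Codeword

variable {K L : Type*} [Field K] [NumberField K] [Field L] [NumberField L] [Algebra K L]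
variable {n : ℕ} [NeZero n]

theorem norm_sq_prod_eq_absNorm [IsGalois K L]
    (hK : IsCyclotomicExtension {4} ℚ K ∨ IsCyclotomicExtension {3} ℚ K) (ι : L →+* ℂ)
    (hn : Module.finrank K L = n)
    (σ : L ≃ₐ[K] L) (hσ : ∀ τ : L ≃ₐ[K] L, τ ∈ Subgroup.zpowers σ) (y : 𝓞 L) :
    ‖ι (∏ i ∈ Finset.range n, (σ ^ i) (y : L))‖ ^ 2 = Ideal.absNorm (Ideal.span {y}) := by
  rw [← hn, ← algebraMap_norm_eq_prod_range σ hσ]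
  have h := norm_sq_eq_abs_norm hK (ι.comp (algebraMap K L)) (Algebra.norm K (y : L))
  rw [RingHom.comp_apply] at h
  rw [h, Algebra.norm_norm, Ideal.absNorm_span_singleton, ← Algebra.coe_norm_int,
    Nat.cast_natAbs]
  simp

theorem det_codeword (ι : L →+* ℂ) (σ : L ≃ₐ[K] L) (γ : 𝓞 K) (α : 𝓞 L) (x : Fin n → 𝓞 L) :
    (codeword ι σ γ α x).det =
      ι (∏ i ∈ Finset.range n, (σ ^ i) (α : L)) * ι (cyclicMatrix σ γ x).det := by
  have h : codeword ι σ γ α x = ι.mapMatrix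
    (Matrix.diagonal (fun i : Fin n => (σ ^ (i : ℕ)) (α : L)) * cyclicMatrix σ γ x) := rfl
  rw [h, ← RingHom.map_det, Matrix.det_mul, map_mul, Matrix.det_diagonal,
    Fin.prod_univ_eq_prod_range (fun i => (σ ^ i) (α : L))]

/-- Elements supported in layer `0` have diagonal matrices; they serve as witnesses for the upper
bounds on minimum determinants. -/
theorem det_cyclicMatrix_single (σ : L ≃ₐ[K] L) (γ : 𝓞 K) (y : 𝓞 L) :
    (cyclicMatrix σ γ (Pi.single (0 : Fin n) y)).det = ∏ i ∈ Finset.range n, (σ ^ i) (y : L) := by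
  have : cyclicMatrix σ γ (Pi.single (0 : Fin n) y) =
      Matrix.diagonal fun i : Fin n => (σ ^ (i : ℕ)) (y : L) := by
    ext i j
    rw [cyclicMatrix, Matrix.of_apply, Matrix.diagonal_apply]
    split_ifs with h1 h2 h2
    · subst h2; simp
    · rw [Pi.single_eq_of_ne (sub_ne_zero.mpr (Ne.symm h2))]; simp
    · exact absurd h2.le h1
    · rw [Pi.single_eq_of_ne (sub_ne_zero.mpr (Ne.symm h2))]; simp
  rw [this, Matrix.det_diagonal, Fin.prod_univ_eq_prod_range (fun i => (σ ^ i) (y : L))]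

theorem codeword_sub (ι : L →+* ℂ) (σ : L ≃ₐ[K] L) (γ : 𝓞 K) (α : 𝓞 L) (x y : Fin n → 𝓞 L) :
    codeword ι σ γ α (x - y) = codeword ι σ γ α x - codeword ι σ γ α y := by
  have : cyclicMatrix σ γ (x - y) = cyclicMatrix σ γ x - cyclicMatrix σ γ y := by
    ext i j
    simp [cyclicMatrix, mul_sub]
  simp only [codeword, this, Matrix.mul_sub]
  exact Matrix.map_sub _ (fun a b => map_sub ι a b) _ _

theorem codeword_add (ι : L →+* ℂ) (σ : L ≃ₐ[K] L) (γ : 𝓞 K) (α : 𝓞 L) (x y : Fin n → 𝓞 L) :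
    codeword ι σ γ α (x + y) = codeword ι σ γ α x + codeword ι σ γ α y := by
  rw [← sub_eq_iff_eq_add, ← codeword_sub, add_sub_cancel_right]

theorem re_det_mul_conjTranspose (A : Matrix (Fin n) (Fin n) ℂ) :
    (A * Aᴴ).det.re = ‖A.det‖ ^ 2 := by
  rw [Matrix.det_mul, Matrix.det_conjTranspose, Complex.star_def, Complex.mul_conj,
    Complex.ofReal_re, Complex.normSq_eq_norm_sq]

/-- The squared determinants of the code lattice are integral multiples of that of the ideal
generator `α`. -/
theorem exists_norm_sq_det_codeword [IsGalois K L]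
    (hK : IsCyclotomicExtension {4} ℚ K ∨ IsCyclotomicExtension {3} ℚ K) (ι : L →+* ℂ)
    (hn : Module.finrank K L = n)
    (σ : L ≃ₐ[K] L) (hσ : ∀ τ : L ≃ₐ[K] L, τ ∈ Subgroup.zpowers σ)
    (γ : 𝓞 K) (hγ : ∀ j : ℕ, 1 ≤ j → j < n → ∀ y : L, Algebra.norm K y ≠ (γ : K) ^ j)
    (α : 𝓞 L) (x : Fin n → 𝓞 L) (hx : x ≠ 0) :
    ∃ N : ℕ, ‖(codeword ι σ γ α x).det‖ ^ 2 = Ideal.absNorm (Ideal.span {α}) * (N : ℝ) ∧ 0 < N ∧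
      ∀ Q : Ideal (𝓞 L), (∀ l, x l ∈ Q) → Ideal.absNorm Q ≤ N := by
  obtain ⟨d, hd, hd0, hQ⟩ := exists_reducedNorm hn σ hσ γ hγ x hx
  refine ⟨_, ?_, ?_, hQ⟩
  · rw [det_codeword, norm_mul, mul_pow, norm_sq_prod_eq_absNorm hK ι hn σ hσ, ← hd,
      ← RingHom.comp_apply, norm_sq_eq_absNorm hK]
  · rw [Nat.pos_iff_ne_zero, Ne, Ideal.absNorm_eq_zero_iff, Ideal.span_singleton_eq_bot]
    exact hd0

theorem norm_sq_det_codeword_single [IsGalois K L]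
    (hK : IsCyclotomicExtension {4} ℚ K ∨ IsCyclotomicExtension {3} ℚ K) (ι : L →+* ℂ)
    (hn : Module.finrank K L = n)
    (σ : L ≃ₐ[K] L) (hσ : ∀ τ : L ≃ₐ[K] L, τ ∈ Subgroup.zpowers σ)
    (γ : 𝓞 K) (α y : 𝓞 L) :
    ‖(codeword ι σ γ α (Pi.single (0 : Fin n) y)).det‖ ^ 2 =
      Ideal.absNorm (Ideal.span {α}) * (Ideal.absNorm (Ideal.span {y}) : ℝ) := by
  rw [det_codeword, det_cyclicMatrix_single, norm_mul, mul_pow,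
    norm_sq_prod_eq_absNorm hK ι hn σ hσ, norm_sq_prod_eq_absNorm hK ι hn σ hσ]

end Codeword

/-! ### Attained minima and the gain formula. -/

section MinimumDeterminant

variable {n : ℕ}

theorem HasMinDet.le {C : Set (Matrix (Fin n) (Fin n) ℂ)} (h : HasMinDet C) {d : ℝ}
    (hd : d ∈ pairDets C) : minDet C ≤ d := h.1.2 hd

/-- A nonempty set of positive integral multiples of a positive real has a least element. -/
theorem hasMinDet_of_multiples {C : Set (Matrix (Fin n) (Fin n) ℂ)} {a : ℝ} (ha : 0 < a)
    {b : ℕ} (hb : 0 < b) (h : ∀ d ∈ pairDets C, ∃ N : ℕ, d = a * N ∧ b ≤ N)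
    (hne : (pairDets C).Nonempty) : HasMinDet C ∧ a * b ≤ minDet C := by
  classical
  have hex : ∃ N : ℕ, a * N ∈ pairDets C := by
    obtain ⟨d, hd⟩ := hne
    obtain ⟨N, rfl, -⟩ := h d hd
    exact ⟨N, hd⟩
  have hleast : IsLeast (pairDets C) (a * (Nat.find hex : ℕ)) := by
    refine ⟨Nat.find_spec hex, fun d hd => ?_⟩
    obtain ⟨N, rfl, -⟩ := h d hd
    exact mul_le_mul_of_nonneg_left (Nat.cast_le.mpr (Nat.find_min' hex hd)) ha.le
  have heq : minDet C = a * (Nat.find hex : ℕ) := hleast.csInf_eq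
  have hle : a * b ≤ minDet C := by
    obtain ⟨N, hN, hbN⟩ := h _ hleast.1
    rw [heq, hN]
    exact mul_le_mul_of_nonneg_left (Nat.cast_le.mpr hbN) ha.le
  refine ⟨⟨heq ▸ hleast, lt_of_lt_of_le ?_ hle⟩, hle⟩
  have : (0 : ℝ) < b := Nat.cast_pos.mpr hb
  positivity

theorem sideInfoGain_eq {C CS : Set (Matrix (Fin n) (Fin n) ℂ)} {R N : ℝ}
    (hR : n * R = Real.logb 2 N / 2) :
    sideInfoGain C CS R =
      20 * Real.logb 10 2 * (Real.log (minDet CS / minDet C) / Real.log N) := by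
  have h2 : Real.log 2 ≠ 0 := (Real.log_pos (by norm_num)).ne'
  rw [sideInfoGain, hR]
  unfold Real.logb
  -- At `log N = 0` both sides are divisions by zero, hence `0`.
  rcases eq_or_ne (Real.log N) 0 with h | h
  · simp [h]
  · field_simp
    ring

theorem logb_ten_two_pos : 0 < Real.logb 10 2 := Real.logb_pos (by norm_num) (by norm_num)

theorem le_sideInfoGain {C CS : Set (Matrix (Fin n) (Fin n) ℂ)} {R N a : ℝ}
    (hR : n * R = Real.logb 2 N / 2) (hN : 1 < N) (ha : 0 < a) (hC : minDet C = a)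
    (hCS : a * N ≤ minDet CS) : 20 * Real.logb 10 2 ≤ sideInfoGain C CS R := by
  have hlog := logb_ten_two_pos
  rw [sideInfoGain_eq hR]
  refine le_mul_of_one_le_right (by positivity) ?_
  rw [one_le_div (Real.log_pos hN)]
  refine Real.log_le_log (by linarith) ?_
  rw [hC, le_div_iff₀ ha, mul_comm]
  exact hCS

theorem sideInfoGain_eq_of_eq {C CS : Set (Matrix (Fin n) (Fin n) ℂ)} {R N a : ℝ}
    (hR : n * R = Real.logb 2 N / 2) (hN : 1 < N) (ha : 0 < a) (hC : minDet C = a)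
    (hCS : minDet CS = a * N) : sideInfoGain C CS R = 20 * Real.logb 10 2 := by
  rw [sideInfoGain_eq hR, hC, hCS, mul_div_cancel_left₀ _ ha.ne', div_self (Real.log_pos hN).ne',
    mul_one]

end MinimumDeterminant

/-! ### Codes as sets of residue-compatible codewords, and the rate. -/

section Codes

variable {K L : Type*} [Field K] [NumberField K] [Field L] [NumberField L] [Algebra K L]
variable {n m : ℕ}

/-- Lets the full code be treated as the case `S = ∅`, where the ideal `Q` is the unit ideal. -/
theorem codebook_eq_subcode (ι : L →+* ℂ) (σ : L ≃ₐ[K] L) (γ : 𝓞 K) (α : 𝓞 L)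
    (q : Fin m → Ideal (𝓞 L)) (M : ((k : Fin m) → 𝓞 L ⧸ q k) → 𝓞 L) (v : Messages n q) :
    codebook (n := n) ι σ γ α q M = subcode ι σ γ α q M ∅ v := by
  ext X
  simp [codebook, subcode]

theorem mem_prod_iff {q : Fin m → Ideal (𝓞 L)}
    (hq : Pairwise fun j k => IsCoprime (q j) (q k)) (S : Finset (Fin m)) (x : 𝓞 L) :
    x ∈ ∏ k ∈ S, q k ↔ ∀ k ∈ S, x ∈ q k := by
  rw [Ideal.prod_eq_iInf_of_pairwise_isCoprime fun i _ j _ hij => hq hij]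
  simp [Submodule.mem_iInf]

variable [NeZero n]

theorem mem_subcode {ι : L →+* ℂ} {σ : L ≃ₐ[K] L} {γ : 𝓞 K} {α : 𝓞 L}
    {q : Fin m → Ideal (𝓞 L)} {M : ((k : Fin m) → 𝓞 L ⧸ q k) → 𝓞 L} (hM : IsLeaderMap q M)
    {S : Finset (Fin m)} {v : Messages n q} {X : Matrix (Fin n) (Fin n) ℂ}
    (hX : X ∈ subcode ι σ γ α q M S v) :
    ∃ x : Fin n → 𝓞 L, (∀ k ∈ S, ∀ l, Ideal.Quotient.mk (q k) (x l) = v k l) ∧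
      X = codeword ι σ γ α x := by
  obtain ⟨d, hd, rfl⟩ := hX
  exact ⟨_, fun k hk l => by rw [hM, hd k hk], rfl⟩

/-- The lattice code of a subcode consists of all codewords compatible with the side
information. -/
theorem mem_latticeCode_subcode {ι : L →+* ℂ} {σ : L ≃ₐ[K] L} {γ : 𝓞 K} {α : 𝓞 L}
    {q : Fin m → Ideal (𝓞 L)} (hq : Pairwise fun j k => IsCoprime (q j) (q k))
    {M : ((k : Fin m) → 𝓞 L ⧸ q k) → 𝓞 L} (hM : IsLeaderMap q M)
    {S : Finset (Fin m)} {v : Messages n q} {X : Matrix (Fin n) (Fin n) ℂ} :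
    X ∈ latticeCode ι σ γ α q (subcode ι σ γ α q M S v) ↔
      ∃ x : Fin n → 𝓞 L, (∀ k ∈ S, ∀ l, Ideal.Quotient.mk (q k) (x l) = v k l) ∧
        X = codeword ι σ γ α x := by
  constructor
  · rintro ⟨Y, hY, z, hz, rfl⟩
    obtain ⟨x, hx, rfl⟩ := mem_subcode hM hY
    refine ⟨x + z, fun k hk l => ?_, (codeword_add ι σ γ α x z).symm⟩
    have : Ideal.Quotient.mk (q k) (z l) = 0 :=
      Ideal.Quotient.eq_zero_iff_mem.mpr ((mem_prod_iff hq _ _).mp (hz l) k (Finset.mem_univ k))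
    rw [Pi.add_apply, map_add, this, add_zero, hx k hk]
  · rintro ⟨x, hx, rfl⟩
    set y : Fin n → 𝓞 L := fun l => M fun k => Ideal.Quotient.mk (q k) (x l) with hy
    refine ⟨codeword ι σ γ α y, ⟨fun k l => Ideal.Quotient.mk (q k) (x l), ?_, rfl⟩, x - y,
      fun l => (mem_prod_iff hq _ _).mpr fun k _ => ?_, ?_⟩
    · exact fun k hk => funext fun l => hx k hk l
    · rw [← Ideal.Quotient.eq_zero_iff_mem, Pi.sub_apply, map_sub, hy, hM, sub_self]
    · rw [← codeword_add, add_sub_cancel]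

/-- Message `s` takes `N(q_s)ⁿ` values, so the factors of `n` cancel: `n · n / (2n²) = 1/2`. -/
theorem card_rate (q : Fin m → Ideal (𝓞 L)) (hq0 : ∀ k, q k ≠ ⊥) (S : Finset (Fin m)) :
    n * sideInfoRate n q S = Real.logb 2 (Ideal.absNorm (∏ s ∈ S, q s) : ℕ) / 2 := by
  have hn : (n : ℝ) ≠ 0 := Nat.cast_ne_zero.mpr (NeZero.ne n)
  rw [map_prod, Nat.cast_prod, Real.logb_prod, sideInfoRate, Finset.mul_sum, Finset.sum_div]
  · refine Finset.sum_congr rfl fun s _ => ?_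
    rw [Nat.card_fun, Nat.card_fin, Nat.cast_pow, Real.logb_pow]
    have : Nat.card (𝓞 L ⧸ q s) = Ideal.absNorm (q s) := by
      rw [Ideal.absNorm_apply, Submodule.cardQuot_apply]
    rw [this]
    field_simp
  · intro s _
    rw [Nat.cast_ne_zero, Ne, Ideal.absNorm_eq_zero_iff]
    exact hq0 s

end Codes

/-! ### Energy and the arithmetic-geometric mean inequality. -/

section Energy

variable {K L : Type*} [Field K] [NumberField K] [Field L] [NumberField L] [Algebra K L]

/-- Multiply the inequalities `t ≤ exp (t - 1)`. -/
theorem prod_le_one_of_sum_le_card {s : Finset ℕ} {f : ℕ → ℝ} (hf : ∀ i ∈ s, 0 ≤ f i)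
    (h : ∑ i ∈ s, f i ≤ s.card) : ∏ i ∈ s, f i ≤ 1 := by
  calc ∏ i ∈ s, f i ≤ ∏ i ∈ s, Real.exp (f i - 1) :=
        Finset.prod_le_prod hf fun i _ => by simpa using Real.add_one_le_exp (f i - 1)
    _ = Real.exp (∑ i ∈ s, f i - s.card) := by
        rw [← Real.exp_sum, Finset.sum_sub_distrib]; simp
    _ ≤ 1 := Real.exp_le_one_iff.mpr (by linarith)

theorem energy_one (n : ℕ) (ι : L →+* ℂ) (σ : L ≃ₐ[K] L) : energy n ι σ 1 = n := by
  simp [energy]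

theorem eq_zero_of_energy_le_zero {n : ℕ} [NeZero n] {ι : L →+* ℂ} {σ : L ≃ₐ[K] L} {x : 𝓞 L}
    (h : energy n ι σ x ≤ 0) : x = 0 := by
  have h0 := (Finset.sum_eq_zero_iff_of_nonneg fun i _ => by positivity).mp
    (h.antisymm (Finset.sum_nonneg fun i _ => by positivity)) 0
    (Finset.mem_range.mpr (NeZero.pos n))
  simpa using h0

/-- An element of energy at most `n` has norm at most one (arithmetic-geometric mean). -/
theorem absNorm_le_one_of_energy_le {n : ℕ} [IsGalois K L]
    (hK : IsCyclotomicExtension {4} ℚ K ∨ IsCyclotomicExtension {3} ℚ K) (ι : L →+* ℂ)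
    (hn : Module.finrank K L = n)
    (σ : L ≃ₐ[K] L) (hσ : ∀ τ : L ≃ₐ[K] L, τ ∈ Subgroup.zpowers σ) {x : 𝓞 L}
    (h : energy n ι σ x ≤ n) : Ideal.absNorm (Ideal.span {x}) ≤ 1 := by
  have : NeZero n := ⟨by rw [← hn]; exact Module.finrank_pos.ne'⟩
  have hle := prod_le_one_of_sum_le_card (s := Finset.range n)
    (f := fun i => ‖ι ((σ ^ i) (x : L))‖ ^ 2) (fun i _ => by positivity)
    (by rw [Finset.card_range]; exact h)
  rw [Finset.prod_pow, ← norm_prod, ← map_prod, norm_sq_prod_eq_absNorm hK ι hn σ hσ] at hle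
  exact_mod_cast hle

end Energy
-- Bounds on minimum determinants and the pairs attaining them.
section Bounds

variable {K L : Type*} [Field K] [NumberField K] [Field L] [NumberField L] [Algebra K L]
  [IsGalois K L]
variable {n m : ℕ} [NeZero n]

/-- The lower bound on the minimum determinant of any code of codewords compatible with the side
information. -/
theorem hasMinDet_of_residues
    (hK : IsCyclotomicExtension {4} ℚ K ∨ IsCyclotomicExtension {3} ℚ K) (ι : L →+* ℂ)
    (hn : Module.finrank K L = n)
    (σ : L ≃ₐ[K] L) (hσ : ∀ τ : L ≃ₐ[K] L, τ ∈ Subgroup.zpowers σ)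
    (γ : 𝓞 K) (hγ : ∀ j : ℕ, 1 ≤ j → j < n → ∀ y : L, Algebra.norm K y ≠ (γ : K) ^ j)
    (α : 𝓞 L) (hα : α ≠ 0) {q : Fin m → Ideal (𝓞 L)} (hq0 : ∀ k, q k ≠ ⊥)
    (hq : Pairwise fun j k => IsCoprime (q j) (q k)) (S : Finset (Fin m)) (v : Messages n q)
    {D : Set (Matrix (Fin n) (Fin n) ℂ)}
    (hD : ∀ X ∈ D, ∃ x : Fin n → 𝓞 L, (∀ k ∈ S, ∀ l, Ideal.Quotient.mk (q k) (x l) = v k l) ∧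
      X = codeword ι σ γ α x) (hne : (pairDets D).Nonempty) :
    HasMinDet D ∧ (Ideal.absNorm (Ideal.span {α}) : ℝ) * (Ideal.absNorm (∏ k ∈ S, q k) : ℕ) ≤
      minDet D := by
  refine hasMinDet_of_multiples ?_ ?_ ?_ hne
  · rw [Nat.cast_pos, Nat.pos_iff_ne_zero, Ne, Ideal.absNorm_eq_zero_iff,
      Ideal.span_singleton_eq_bot]
    exact hα
  · rw [Nat.pos_iff_ne_zero, Ne, Ideal.absNorm_eq_zero_iff]
    exact Finset.prod_ne_zero_iff.mpr fun k _ => hq0 k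
  · rintro d ⟨X, hX, X', hX', hXX', rfl⟩
    obtain ⟨x, hx, rfl⟩ := hD X hX
    obtain ⟨x', hx', rfl⟩ := hD X' hX'
    have hne : x - x' ≠ 0 := fun h => hXX' (by rw [sub_eq_zero.mp h])
    obtain ⟨N, hN, -, hQ⟩ := exists_norm_sq_det_codeword hK ι hn σ hσ γ hγ α (x - x') hne
    refine ⟨N, ?_, hQ _ fun l => (mem_prod_iff hq _ _).mpr fun k hk => ?_⟩
    · rw [re_det_mul_conjTranspose, ← codeword_sub, hN]
    · rw [← Ideal.Quotient.eq_zero_iff_mem, Pi.sub_apply, map_sub, hx k hk, hx' k hk, sub_self]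

theorem codeword_injective
    (hK : IsCyclotomicExtension {4} ℚ K ∨ IsCyclotomicExtension {3} ℚ K) (ι : L →+* ℂ)
    (hn : Module.finrank K L = n)
    (σ : L ≃ₐ[K] L) (hσ : ∀ τ : L ≃ₐ[K] L, τ ∈ Subgroup.zpowers σ)
    (γ : 𝓞 K) (hγ : ∀ j : ℕ, 1 ≤ j → j < n → ∀ y : L, Algebra.norm K y ≠ (γ : K) ^ j)
    (α : 𝓞 L) (hα : α ≠ 0) : Function.Injective (codeword (n := n) ι σ γ α) := by
  intro x x' h
  by_contra hne
  obtain ⟨N, hN, hpos, -⟩ :=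
    exists_norm_sq_det_codeword hK ι hn σ hσ γ hγ α (x - x') (sub_ne_zero.mpr hne)
  rw [codeword_sub, h, sub_self, Matrix.det_zero, norm_zero, zero_pow two_ne_zero, eq_comm,
    mul_eq_zero, Nat.cast_eq_zero, Nat.cast_eq_zero, Ideal.absNorm_eq_zero_iff,
    Ideal.span_singleton_eq_bot] at hN
  exact hN.elim hα hpos.ne'

theorem mem_pairDets_of_codeword_single
    (hK : IsCyclotomicExtension {4} ℚ K ∨ IsCyclotomicExtension {3} ℚ K) (ι : L →+* ℂ)
    (hn : Module.finrank K L = n)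
    (σ : L ≃ₐ[K] L) (hσ : ∀ τ : L ≃ₐ[K] L, τ ∈ Subgroup.zpowers σ)
    (γ : 𝓞 K) (hγ : ∀ j : ℕ, 1 ≤ j → j < n → ∀ y : L, Algebra.norm K y ≠ (γ : K) ^ j)
    (α : 𝓞 L) (hα : α ≠ 0) {D : Set (Matrix (Fin n) (Fin n) ℂ)} {x : Fin n → 𝓞 L} {y : 𝓞 L}
    (hy : y ≠ 0) (hx : codeword ι σ γ α x ∈ D)
    (hxy : codeword ι σ γ α (x + Pi.single 0 y) ∈ D) :
    (Ideal.absNorm (Ideal.span {α}) : ℝ) * Ideal.absNorm (Ideal.span {y}) ∈ pairDets D := by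
  refine ⟨_, hxy, _, hx, fun h => ?_, ?_⟩
  · have := codeword_injective hK ι hn σ hσ γ hγ α hα h
    rw [add_eq_left, Pi.single_eq_zero_iff] at this
    exact hy this
  · rw [re_det_mul_conjTranspose, ← codeword_sub, add_sub_cancel_left,
      norm_sq_det_codeword_single hK ι hn σ hσ]

theorem mem_pairDets_latticeCode
    (hK : IsCyclotomicExtension {4} ℚ K ∨ IsCyclotomicExtension {3} ℚ K) (ι : L →+* ℂ)
    (hn : Module.finrank K L = n)
    (σ : L ≃ₐ[K] L) (hσ : ∀ τ : L ≃ₐ[K] L, τ ∈ Subgroup.zpowers σ)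
    (γ : 𝓞 K) (hγ : ∀ j : ℕ, 1 ≤ j → j < n → ∀ y : L, Algebra.norm K y ≠ (γ : K) ^ j)
    (α : 𝓞 L) (hα : α ≠ 0) {q : Fin m → Ideal (𝓞 L)}
    (hq : Pairwise fun j k => IsCoprime (q j) (q k))
    {M : ((k : Fin m) → 𝓞 L ⧸ q k) → 𝓞 L} (hM : IsLeaderMap q M)
    (S : Finset (Fin m)) (v : Messages n q) {y : 𝓞 L} (hy : y ≠ 0) (hyS : y ∈ ∏ k ∈ S, q k) :
    (Ideal.absNorm (Ideal.span {α}) : ℝ) * Ideal.absNorm (Ideal.span {y}) ∈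
      pairDets (latticeCode ι σ γ α q (subcode ι σ γ α q M S v)) := by
  have hv : ∀ k l, Ideal.Quotient.mk (q k) (M fun k => v k l) = v k l := fun k l => hM _ k
  refine mem_pairDets_of_codeword_single hK ι hn σ hσ γ hγ α hα
    (x := fun l => M fun k => v k l) hy ?_ ?_ <;> rw [mem_latticeCode_subcode hq hM]
  · exact ⟨_, fun k _ l => hv k l, rfl⟩
  · refine ⟨_, fun k hk l => ?_, rfl⟩
    rw [Pi.add_apply, map_add, hv, add_eq_left, Ideal.Quotient.eq_zero_iff_mem]
    rcases eq_or_ne l 0 with rfl | hl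
    · rw [Pi.single_eq_same]
      exact (mem_prod_iff hq _ _).mp hyS k hk
    · rw [Pi.single_eq_of_ne hl]
      exact zero_mem _

end Bounds
end LSTIC

/-! ### The theorem. -/

open LSTIC in
theorem theorem1 {K L : Type*} [Field K] [NumberField K] [Field L] [NumberField L]
    [Algebra K L] [IsGalois K L]
    -- the base field is `ℚ(i)` or `ℚ(ω)`
    (hK : IsCyclotomicExtension {4} ℚ K ∨ IsCyclotomicExtension {3} ℚ K)
    (ι : L →+* ℂ) (n : ℕ) (hn : Module.finrank K L = n)
    -- the Galois group of `L/K` is cyclic, generated by `σ`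
    (σ : L ≃ₐ[K] L) (hσ : ∀ τ : L ≃ₐ[K] L, τ ∈ Subgroup.zpowers σ)
    -- none of `γ, …, γⁿ⁻¹` is a norm from `L`
    (γ : 𝓞 K) (hγ : ∀ j : ℕ, 1 ≤ j → j < n → ∀ y : L, Algebra.norm K y ≠ (γ : K) ^ j)
    (α : 𝓞 L) (hα : α ≠ 0)
    (m : ℕ) (q : Fin m → Ideal (𝓞 L)) (hq0 : ∀ k, q k ≠ ⊥)
    (hq : Pairwise fun j k => IsCoprime (q j) (q k))
    (M : ((k : Fin m) → 𝓞 L ⧸ q k) → 𝓞 L) (hM : LSTIC.IsLeaderMap q M)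
    -- the side information, of positive rate
    (S : Finset (Fin m)) (hS : ∃ s ∈ S, q s ≠ ⊤) (v : LSTIC.Messages n q)
    -- the codebook, the subcode given the side information, and the rate of the latter
    (C CS : Set (Matrix (Fin n) (Fin n) ℂ)) (R : ℝ)
    (hC : C = LSTIC.codebook ι σ γ α q M) (hCS : CS = LSTIC.subcode ι σ γ α q M S v)
    (hR : R = LSTIC.sideInfoRate n q S)
    -- the lattice codes from which the codebook and the subcode are carved
    (Λ ΛS : Set (Matrix (Fin n) (Fin n) ℂ))
    (hΛ : Λ = LSTIC.latticeCode ι σ γ α q C) (hΛS : ΛS = LSTIC.latticeCode ι σ γ α q CS) :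
    -- minimum determinants taken over the lattice codes
    (0 < R ∧ LSTIC.HasMinDet Λ ∧ LSTIC.HasMinDet ΛS ∧
      20 * Real.logb 10 2 ≤ LSTIC.sideInfoGain Λ ΛS R ∧
      ((∀ k, (q k).IsPrincipal) → LSTIC.sideInfoGain Λ ΛS R = 20 * Real.logb 10 2)) ∧
    -- minimum determinants taken over the finite codebooks
    (LSTIC.HasMinEnergy n ι σ q M → (∃ k, k ∉ S ∧ q k ≠ ⊤) →
      LSTIC.HasMinDet C ∧ LSTIC.HasMinDet CS ∧
      20 * Real.logb 10 2 ≤ LSTIC.sideInfoGain C CS R) := by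
  have : NeZero n := ⟨by rw [← hn]; exact Module.finrank_pos.ne'⟩
  have hCM : ∀ w : Messages n q, encode ι σ γ α q M w ∈ C := fun w => by rw [hC]; exact ⟨w, rfl⟩
  rw [codebook_eq_subcode ι σ γ α q M v] at hC
  set a : ℝ := Nat.cast (Ideal.absNorm (Ideal.span {α})) with ha
  set Q : Ideal (𝓞 L) := ∏ k ∈ S, q k with hQ
  have ha0 : 0 < a := by
    rw [ha, Nat.cast_pos, Nat.pos_iff_ne_zero, Ne, Ideal.absNorm_eq_zero_iff,
      Ideal.span_singleton_eq_bot]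
    exact hα
  have hQ0 : Q ≠ ⊥ := Finset.prod_ne_zero_iff.mpr fun k _ => hq0 k
  have hQ1 : (1 : ℝ) < (Ideal.absNorm Q : ℕ) := by
    obtain ⟨s, hsS, hs⟩ := hS
    have h0 : Ideal.absNorm Q ≠ 0 := fun h => hQ0 (Ideal.absNorm_eq_zero_iff.mp h)
    have h1 : Ideal.absNorm Q ≠ 1 := fun h => hs <| by
      rw [Ideal.absNorm_eq_one_iff, Ideal.eq_top_iff_one, mem_prod_iff hq] at h
      exact (Ideal.eq_top_iff_one _).mpr (h s hsS)
    rw [Nat.one_lt_cast]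
    omega
  have hrate : n * R = Real.logb 2 (Ideal.absNorm Q : ℕ) / 2 := by rw [hR, card_rate q hq0 S]
  have hRpos : 0 < R := by
    have h := Real.logb_pos (b := 2) (by norm_num) hQ1
    refine pos_of_mul_pos_right (a := (n : ℝ)) ?_ n.cast_nonneg
    rw [hrate]
    linarith
  have hlow : ∀ {T : Finset (Fin m)} {D : Set (Matrix (Fin n) (Fin n) ℂ)}, _ → _ → _ :=
    fun {T D} => hasMinDet_of_residues (D := D) hK ι hn σ hσ γ hγ α hα hq0 hq T v
  have hone : Ideal.absNorm (Ideal.span {(1 : 𝓞 L)}) = 1 := by simp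
  -- With no side information the general lower bound is `a` itself, so one pair with determinant
  -- `a` settles the minimum.
  have hmin : ∀ {D : Set (Matrix (Fin n) (Fin n) ℂ)},
      (∀ X ∈ D, ∃ x : Fin n → 𝓞 L, X = codeword ι σ γ α x) → a ∈ pairDets D →
      HasMinDet D ∧ minDet D = a := by
    intro D hD haD
    obtain ⟨h1, h2⟩ := hlow (T := ∅) (D := D)
      (fun X hX => (hD X hX).imp fun x hx => ⟨by simp, hx⟩) ⟨a, haD⟩
    refine ⟨h1, le_antisymm (h1.le haD) ?_⟩
    rwa [Finset.prod_empty, map_one, Nat.cast_one, mul_one] at h2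
  have hmemΛS : ∀ {y : 𝓞 L}, y ≠ 0 → y ∈ Q → a * Ideal.absNorm (Ideal.span {y}) ∈ pairDets ΛS := by
    intro y hy hyQ
    rw [hΛS, hCS]
    exact mem_pairDets_latticeCode hK ι hn σ hσ γ hγ α hα hq hM S v hy hyQ
  have hΛmin : HasMinDet Λ ∧ minDet Λ = a := by
    refine hmin (fun X hX => ?_) ?_
    · rw [hΛ, hC, mem_latticeCode_subcode hq hM] at hX
      exact hX.imp fun x hx => hx.2
    · have h := mem_pairDets_latticeCode hK ι hn σ hσ γ hγ α hα hq hM ∅ v one_ne_zero (by simp)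
      rw [hone, Nat.cast_one, mul_one] at h
      rw [hΛ, hC]
      exact h
  have hΛSmin : HasMinDet ΛS ∧ a * (Ideal.absNorm Q : ℕ) ≤ minDet ΛS := by
    refine hlow (fun X hX => ?_) ?_
    · rwa [hΛS, hCS, mem_latticeCode_subcode hq hM] at hX
    · obtain ⟨y, hy, hy0⟩ := Submodule.exists_mem_ne_zero_of_ne_bot hQ0
      exact ⟨_, hmemΛS hy0 hy⟩
  refine ⟨⟨hRpos, hΛmin.1, hΛSmin.1, le_sideInfoGain hrate hQ1 ha0 hΛmin.2 hΛSmin.2, ?_⟩, ?_⟩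
  · intro hprin
    refine sideInfoGain_eq_of_eq hrate hQ1 ha0 hΛmin.2 (le_antisymm ?_ hΛSmin.2)
    -- The product of the generators over `S` generates `Q`, so its norm meets the lower bound
    -- exactly.
    choose g hg using fun k => (hprin k).principal
    have hQg : Q = Ideal.span {∏ k ∈ S, g k} := by
      rw [hQ, ← Ideal.prod_span_singleton]
      exact Finset.prod_congr rfl fun k _ => hg k
    have hg0 : ∏ k ∈ S, g k ≠ 0 := fun h => hQ0 (by rw [hQg, h]; simp)
    rw [hQg]
    exact hΛSmin.1.le (hmemΛS hg0 (hQg ▸ Ideal.mem_span_singleton_self _))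
  · rintro hE ⟨k₀, hk₀S, hk₀⟩
    have hM0 : M 0 = 0 := by
      have h := hE 0 0 fun k => by simp
      exact eq_zero_of_energy_le_zero (h.trans_eq (by simp [energy]))
    -- The representative `1` has energy `n`, so `u` has energy at most `n` and norm at most one; `u
    -- ≠ 0` because `1 ∉ q k₀`. The codewords of `0` and of `u` in layer `0` then attain `a`.
    set u := M 1 with hu
    have hu0 : u ≠ 0 := by
      intro h
      have h1 := hM 1 k₀
      rw [← hu, h, map_zero, Pi.one_apply, eq_comm, ← map_one (Ideal.Quotient.mk (q k₀)),
        Ideal.Quotient.eq_zero_iff_mem] at h1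
      exact hk₀ ((Ideal.eq_top_iff_one _).mpr h1)
    have hu1 : Ideal.absNorm (Ideal.span {u}) = 1 := by
      refine le_antisymm (absNorm_le_one_of_energy_le hK ι hn σ hσ ?_) ?_
      · exact (hE 1 1 fun k => by simp).trans_eq (energy_one n ι σ)
      · rw [Nat.one_le_iff_ne_zero, Ne, Ideal.absNorm_eq_zero_iff, Ideal.span_singleton_eq_bot]
        exact hu0
    have hCmin : HasMinDet C ∧ minDet C = a := by
      refine hmin (fun X hX => ?_) ?_
      · rw [hC] at hX
        exact (mem_subcode hM hX).imp fun x hx => hx.2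
      · have h := mem_pairDets_of_codeword_single hK ι hn σ hσ γ hγ α hα (D := C) (x := 0) hu0
          ?_ ?_
        · rwa [hu1, Nat.cast_one, mul_one] at h
        · convert hCM 0 using 1
          exact congrArg _ (funext fun l => hM0.symm)
        · convert hCM (fun k l => if l = 0 then 1 else 0) using 1
          refine congrArg _ (funext fun l => ?_)
          rw [zero_add]
          rcases eq_or_ne l 0 with rfl | hl
          · simp only [Pi.single_eq_same, if_true]; rfl
          · simp only [Pi.single_eq_of_ne hl, if_neg hl]; exact hM0.symm
    have hCSmin : HasMinDet CS ∧ a * (Ideal.absNorm Q : ℕ) ≤ minDet CS := by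
      refine hlow (fun X hX => ?_) ?_
      · rw [hCS] at hX
        exact mem_subcode hM hX
      · rw [hCS]
        -- Changing the unknown message `k₀` by `1` keeps the side information and, as `q k₀ ≠ ⊤`,
        -- changes the codeword.
        refine ⟨_, _, ⟨v, fun _ _ => rfl, rfl⟩, _, ⟨Function.update v k₀ (v k₀ + 1), ?_, rfl⟩,
          fun h => ?_, rfl⟩
        · intro k hk
          exact Function.update_of_ne (by rintro rfl; exact hk₀S hk) _ _
        · have h1 := congrFun (codeword_injective hK ι hn σ hσ γ hγ α hα h) 0
          have h2 := congrArg (Ideal.Quotient.mk (q k₀)) h1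
          rw [hM, hM, Function.update_self, Pi.add_apply, eq_comm, add_eq_left, Pi.one_apply,
            ← map_one (Ideal.Quotient.mk (q k₀)), Ideal.Quotient.eq_zero_iff_mem] at h2
          exact hk₀ ((Ideal.eq_top_iff_one _).mpr h2)
    exact ⟨hCmin.1, hCSmin.1, le_sideInfoGain hrate hQ1 ha0 hCmin.2 hCSmin.2⟩
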